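/- Let $d\ge 1$, $M\ge d+1$ and $N\ge 1$ be integers, let $T,L,S>0$ and $K\geq 0$ be real numbers, put $\Delta t=T/N$, and let $x_0\in\mathbb R^d$. Let $|\cdot|$ denote the Euclidean norm of a vector and the Euclidean operator norm of a matrix. Let $f_1,\dots,f_M:\mathbb R^d\to\mathbb R^d$ be differentiable functions, with Jacobians $f_i'$, such that for all $1\le i\le M$ and all $x,z\in\mathbb R^d$ $$|f_i(x)-f_i(z)-f_i'(z)(x-z)|\le S|x-z|^2,\qquad |f_i(x)|\le K,\qquad |f_i'(x)|\le L,$$ and let $F(x)=\{f_1(x),\dots,f_M(x)\}$. Let $x:[0,T]\to\mathbb R^d$ be a solution of the differential inclusion $x'(t)\in F(x(t))$, $x(0)=x_0$, that is, an absolutely continuous function with $x(0)=x_0$ and $x'(t)\in F(x(t))$ for almost every $t\in[0,T]$. Then there exists a Forward Euler path $\xi_0,\dots,\xi_N$, that is, $\xi_{n+1}\in\xi_n+\Delta t\,F(\xi_n)$ for $n=0,\dots,N-1$ with the same initial value $\xi_0=x_0$, such that $$\begin{aligned}\max_{0\le n\le N}|x(n\Delta t)-\xi_n|\le{}&\Big(e^{LT}\big(KLT+K(8M-10)\big)+2K(M-1)\Big)\Delta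 t\\&+e^{LT}\Big(KL(M-1)(M-2)+2KL\,\frac{(M-1)^3-(M-1)}{3}(1+L\Delta t)^{M-3}+2SK^2\,\frac{M(M-1)(2M-1)}{3L}\Big)\Delta t^2 .\end{aligned}$$ -/

import Mathlib

open Set MeasureTheory

/-- The finite-valued right-hand side `F(x) = {f₁(x), …, f_M(x)}`. -/
def finiteInclusion {d M : ℕ}
    (f : Fin M → EuclideanSpace ℝ (Fin d) → EuclideanSpace ℝ (Fin d)) :
    EuclideanSpace ℝ (Fin d) → Set (EuclideanSpace ℝ (Fin d)) :=
  fun x => Set.range fun i => f i x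

/-- `x` solves the differential inclusion `x'(t) ∈ F(x(t))`, `x(0) = x₀`, on `[0, T]`: it is
absolutely continuous on `[0, T]` and at almost every `t ∈ [0, T]` it has a derivative, which
belongs to `F(x(t))`. Values of `x` outside `[0, T]` play no role. -/
structure IsInclusionSolution {d : ℕ}
    (F : EuclideanSpace ℝ (Fin d) → Set (EuclideanSpace ℝ (Fin d)))
    (x₀ : EuclideanSpace ℝ (Fin d)) (T : ℝ) (x : ℝ → EuclideanSpace ℝ (Fin d)) : Prop where
  absolutelyContinuous : AbsolutelyContinuousOnInterval x 0 T
  initial : x 0 = x₀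
  deriv_mem : ∀ᵐ t ∂(volume.restrict (Set.Icc 0 T)), ∃ v ∈ F (x t), HasDerivAt x v t

/-- `ξ₀, …, ξ_N` is a Forward Euler path with step `Δt`:
`ξ₀ = x₀` and `ξ_{n+1} ∈ ξ_n + Δt F(ξ_n)` for `0 ≤ n ≤ N - 1`.
The entries `ξ n` with `n > N` play no role. -/
structure IsForwardEulerPath {d : ℕ}
    (F : EuclideanSpace ℝ (Fin d) → Set (EuclideanSpace ℝ (Fin d)))
    (x₀ : EuclideanSpace ℝ (Fin d)) (Δt : ℝ) (N : ℕ)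
    (ξ : ℕ → EuclideanSpace ℝ (Fin d)) : Prop where
  initial : ξ 0 = x₀
  step : ∀ n < N, ∃ v ∈ F (ξ n), ξ (n + 1) = ξ n + Δt • v

/-!
By the mean value inequality, the `f i` are Lipschitz with constant `L`. The estimate follows from
this and the bound `K` in three steps.

*Averaging.* Put `tₙ = n Δt`. The velocities of `x` on `[tₙ, tₙ₊₁]` lie almost everywhere within
`K L Δt` of the convex hull of the vectors `f i (x tₙ)`. The mean velocity over the step therefore
does too, which gives convex weights `w n` with
`x tₙ₊₁ - x tₙ = Δt ∑ i, w n i • f i (x tₙ) + O(K L Δt²)`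
(`exists_weights_norm_sub_le`). The tool is a mean value theorem for absolutely continuous curves
whose velocity lies in a closed convex set
(`AbsolutelyContinuousOnInterval.inv_smul_sub_mem_of_convex`).

*Rounding.* The weights are replaced by single indices `σ n`, chosen greedily: each step picks the
index whose number of uses lags furthest behind its accumulated weight. With `M` indices, the
discrepancy `D n i = #{k < n | σ k = i} - ∑ k < n, w k i` then satisfies
`∑ i, |D n i| ≤ 2 (M - 1)` for every `n` (`exists_rounding`).

*Stability.* Let `ξ` be the Euler path that uses `f (σ n)` in step `n`, and consider the corrected
error `W n = x tₙ - ξ n + Δt ∑ i, D n i • f i (x tₙ)`. In `W (n + 1) - W n` the weights cancel, by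
a summation by parts, and what remains is at most
`L Δt ‖x tₙ - ξ n‖ + K L Δt² (1 + 2 (M - 1))`. The discrete Grönwall inequality bounds `W`, hence
the error (`norm_sub_le_of_rounding`); the bound obtained is
`K Δt exp (L T) (L T + 4 (M - 1))` at most, and `4 (M - 1) ≤ 8 M - 10` since `M ≥ 2`.
-/

/-! ### Absolutely continuous curves with velocity in a convex set -/

theorem LipschitzWith.comp_absolutelyContinuousOnInterval {X Y : Type*} [PseudoMetricSpace X]
    [PseudoMetricSpace Y] {C : NNReal} {g : X → Y} (hg : LipschitzWith C g) {x : ℝ → X} {a b : ℝ}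
    (hx : AbsolutelyContinuousOnInterval x a b) :
    AbsolutelyContinuousOnInterval (fun t => g (x t)) a b := by
  have hCx := Filter.Tendsto.const_mul (C : ℝ) hx
  rw [mul_zero] at hCx
  refine squeeze_zero (fun E => Finset.sum_nonneg fun i _ => dist_nonneg) (fun E => ?_) hCx
  rw [Finset.mul_sum]
  exact Finset.sum_le_sum fun i _ => hg.dist_le_mul _ _

section MeanValue

variable {E : Type*} [NormedAddCommGroup E] [NormedSpace ℝ E]

/-- Mean value theorem: if the velocity of an absolutely continuous curve lies almost everywhere in
a closed convex set, then so does its mean velocity. -/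
theorem AbsolutelyContinuousOnInterval.inv_smul_sub_mem_of_convex {x : ℝ → E} {a b : ℝ}
    (hx : AbsolutelyContinuousOnInterval x a b) (hab : a < b) {C : Set E} (hC : Convex ℝ C)
    (hC' : IsClosed C) (hv : ∀ᵐ t, t ∈ Icc a b → ∃ v ∈ C, HasDerivAt x v t) :
    (b - a)⁻¹ • (x b - x a) ∈ C := by
  by_contra hmem
  -- A functional separating the mean velocity from `C` reduces the claim to real-valued curves.
  obtain ⟨ℓ, u, hlt, hu⟩ := geometric_hahn_banach_closed_point hC hC' hmem
  have hℓx := ℓ.lipschitz.comp_absolutelyContinuousOnInterval hx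
  have hle : ∫ t in a..b, deriv (fun t => ℓ (x t)) t ≤ ∫ _ in a..b, u := by
    refine intervalIntegral.integral_mono_ae_restrict hab.le hℓx.intervalIntegrable_deriv
      intervalIntegrable_const ?_
    rw [Filter.EventuallyLE, ae_restrict_iff' measurableSet_Icc]
    filter_upwards [hv] with t ht htab
    obtain ⟨v, hvC, hvd⟩ := ht htab
    have hd : HasDerivAt (fun t => ℓ (x t)) (ℓ v) t := ℓ.hasFDerivAt.comp_hasDerivAt t hvd
    rw [hd.deriv]
    exact (hlt v hvC).le
  rw [hℓx.integral_deriv_eq_sub, intervalIntegral.integral_const, smul_eq_mul] at hle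
  rw [map_smul, map_sub, smul_eq_mul, inv_mul_eq_div, lt_div_iff₀ (sub_pos.2 hab)] at hu
  linarith

theorem AbsolutelyContinuousOnInterval.norm_sub_le_of_velocity_le {x : ℝ → E} {a b K : ℝ}
    (hx : AbsolutelyContinuousOnInterval x a b) (hab : a ≤ b)
    (hv : ∀ᵐ t, t ∈ Icc a b → ∃ v, ‖v‖ ≤ K ∧ HasDerivAt x v t) :
    ‖x b - x a‖ ≤ K * (b - a) := by
  rcases hab.eq_or_lt with rfl | hab
  · simp
  have hmem := hx.inv_smul_sub_mem_of_convex hab (convex_closedBall 0 K)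
    Metric.isClosed_closedBall (by simpa using hv)
  have hpos := sub_pos.2 hab
  rwa [mem_closedBall_zero_iff, norm_smul, norm_inv, Real.norm_of_nonneg hpos.le, inv_mul_eq_div,
    div_le_iff₀ hpos] at hmem

/-- Averaging over one time step: up to an error quadratic in the length of the step, the increment
of a solution of `x' ∈ {f i x}` is the Euler increment of a convex combination of the `f i`. -/
theorem exists_weights_norm_sub_le {ι : Type*} [Fintype ι] {f : ι → E → E} {K L : ℝ}
    (hK : ∀ i y, ‖f i y‖ ≤ K) (hK₀ : 0 ≤ K) (hL₀ : 0 ≤ L)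
    (hL : ∀ i y z, ‖f i y - f i z‖ ≤ L * ‖y - z‖)
    {x : ℝ → E} {a b : ℝ} (hx : AbsolutelyContinuousOnInterval x a b) (hab : a < b)
    (hv : ∀ᵐ t, t ∈ Icc a b → ∃ i, HasDerivAt x (f i (x t)) t) :
    ∃ w ∈ stdSimplex ℝ ι,
      ‖x b - x a - (b - a) • ∑ i, w i • f i (x a)‖ ≤ K * L * (b - a) ^ 2 := by
  classical
  let φ : (ι → ℝ) →ₗ[ℝ] E := Fintype.linearCombination ℝ fun i => f i (x a)
  have hφ (w : ι → ℝ) : φ w = ∑ i, w i • f i (x a) := rfl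
  have hpos := sub_pos.2 hab
  -- `s` is the convex hull of the vectors `f i (x a)`.
  let s : Set E := φ '' stdSimplex ℝ ι
  have hsconv : Convex ℝ s := (convex_stdSimplex ℝ ι).linear_image φ
  have hscomp : IsCompact s :=
    (isCompact_stdSimplex ℝ ι).image (LinearMap.continuous_of_finiteDimensional φ)
  have hmem : (b - a)⁻¹ • (x b - x a) ∈ Metric.cthickening (K * L * (b - a)) s := by
    refine hx.inv_smul_sub_mem_of_convex hab (hsconv.cthickening _) Metric.isClosed_cthickening ?_
    filter_upwards [hv] with t ht htab
    obtain ⟨i, hi⟩ := ht htab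
    refine ⟨_, Metric.mem_cthickening_of_dist_le _ (f i (x a)) _ s
      ⟨Pi.single i 1, single_mem_stdSimplex ℝ i, ?_⟩ ?_, hi⟩
    · simp [φ]
    · have hxt : ‖x t - x a‖ ≤ K * (t - a) := by
        refine (hx.mono ?_).norm_sub_le_of_velocity_le htab.1 ?_
        · rw [uIcc_of_le htab.1, uIcc_of_le hab.le]
          exact Icc_subset_Icc_right htab.2
        · filter_upwards [hv] with r hr hrt
          obtain ⟨j, hj⟩ := hr ⟨hrt.1, hrt.2.trans htab.2⟩
          exact ⟨_, hK j _, hj⟩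
      calc dist (f i (x t)) (f i (x a)) ≤ L * ‖x t - x a‖ := by
            rw [dist_eq_norm]; exact hL i _ _
        _ ≤ L * (K * (b - a)) := by
            gcongr
            refine hxt.trans ?_
            gcongr
            exact htab.2
        _ = K * L * (b - a) := by ring
  rw [hscomp.cthickening_eq_biUnion_closedBall (by positivity)] at hmem
  simp only [mem_iUnion, Metric.mem_closedBall, dist_eq_norm, exists_prop] at hmem
  obtain ⟨_, ⟨w, hw, rfl⟩, hle⟩ := hmem
  refine ⟨w, hw, ?_⟩
  have hscale : x b - x a - (b - a) • ∑ i, w i • f i (x a)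
      = (b - a) • ((b - a)⁻¹ • (x b - x a) - φ w) := by
    rw [smul_sub, smul_inv_smul₀ hpos.ne', hφ]
  rw [hscale, norm_smul, Real.norm_of_nonneg hpos.le]
  calc (b - a) * _ ≤ (b - a) * (K * L * (b - a)) := by gcongr
    _ = K * L * (b - a) ^ 2 := by ring

end MeanValue

/-! ### Rounding a sequence of weights to a sequence of indices -/

/-- One greedy step: the index with the smallest value of `D - w` is used, so that the increment
`1` keeps every entry of the discrepancy below `1 - 1 / card ι`. -/
theorem exists_rounding_step {ι : Type*} [Fintype ι] [DecidableEq ι] [Nonempty ι]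
    {D w : ι → ℝ} (hw : w ∈ stdSimplex ℝ ι) (hsum : ∑ i, D i = 0)
    (hD : ∀ i, D i ≤ 1 - (Fintype.card ι : ℝ)⁻¹) :
    ∃ j, ∑ i, (D - w + Pi.single j 1 : ι → ℝ) i = 0 ∧
      ∀ i, (D - w + Pi.single j 1 : ι → ℝ) i ≤ 1 - (Fintype.card ι : ℝ)⁻¹ := by
  obtain ⟨j, -, hj⟩ := Finset.exists_min_image Finset.univ (D - w) Finset.univ_nonempty
  have htotal : ∑ i, (D - w) i = -1 := by
    simp [Finset.sum_sub_distrib, hsum, hw.2]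
  have hcard : (0 : ℝ) < Fintype.card ι := by exact_mod_cast Fintype.card_pos
  -- The least entry is at most the average.
  have hmin : (D - w) j ≤ -(Fintype.card ι : ℝ)⁻¹ := by
    have h := Finset.card_nsmul_le_sum Finset.univ (D - w) _ hj
    rw [htotal, nsmul_eq_mul, Finset.card_univ] at h
    rw [← neg_one_mul, ← div_eq_mul_inv, le_div_iff₀ hcard]
    linarith
  refine ⟨j, ?_, fun i => ?_⟩
  · simp only [Pi.add_apply, Finset.sum_add_distrib, htotal]
    simp
  · rcases eq_or_ne i j with rfl | hij
    · simp only [Pi.add_apply, Pi.single_eq_same]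
      linarith
    · simp only [Pi.add_apply, Pi.sub_apply, Pi.single_eq_of_ne hij]
      linarith [hD i, hw.1 i]

/-- Any sequence of convex weights can be rounded to a sequence of indices with bounded
discrepancy: `D n i` is the number of `k < n` with `σ k = i`, minus `∑ k < n, w k i`. -/
theorem exists_rounding {ι : Type*} [Fintype ι] [DecidableEq ι] [Nonempty ι]
    {w : ℕ → ι → ℝ} (hw : ∀ n, w n ∈ stdSimplex ℝ ι) :
    ∃ (σ : ℕ → ι) (D : ℕ → ι → ℝ), D 0 = 0 ∧
      (∀ n, D (n + 1) = D n - w n + Pi.single (σ n) 1) ∧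
      ∀ n, ∑ i, |D n i| ≤ 2 * ((Fintype.card ι : ℝ) - 1) := by
  have hcard : (1 : ℝ) ≤ Fintype.card ι := by exact_mod_cast Fintype.card_pos (α := ι)
  have hc : 0 ≤ 1 - (Fintype.card ι : ℝ)⁻¹ := sub_nonneg.2 (inv_le_one_of_one_le₀ hcard)
  let A := {D : ι → ℝ // ∑ i, D i = 0 ∧ ∀ i, D i ≤ 1 - (Fintype.card ι : ℝ)⁻¹}
  choose g hg using fun (n : ℕ) (D : A) => exists_rounding_step (hw n) D.2.1 D.2.2
  let D : ℕ → A := fun n =>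
    Nat.rec ⟨0, by simp, fun i => hc⟩ (fun n D => ⟨D.1 - w n + Pi.single (g n D) 1, hg n D⟩) n
  refine ⟨fun n => g n (D n), fun n => (D n).1, rfl, fun n => rfl, fun n => ?_⟩
  obtain ⟨hsum, hle⟩ := (D n).2
  -- `|d| ≤ 2 c - d` whenever `d ≤ c` and `0 ≤ c`, and the entries `d` add up to zero.
  calc ∑ i, |(D n).1 i| ≤ ∑ i, (2 * (1 - (Fintype.card ι : ℝ)⁻¹) - (D n).1 i) :=
        Finset.sum_le_sum fun i _ => abs_le.2 ⟨by linarith, by linarith [hle i]⟩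
    _ = 2 * ((Fintype.card ι : ℝ) - 1) := by
        rw [Finset.sum_sub_distrib, hsum, Finset.sum_const, Finset.card_univ, nsmul_eq_mul]
        field_simp
        ring

/-! ### Stability of the Euler path -/

/-- Discrete Grönwall inequality with zero initial value, in the form used for Euler paths. -/
theorem le_exp_sub_one_mul_of_le_one_add_mul {u : ℕ → ℝ} {a b : ℝ} {N : ℕ} (ha : 0 ≤ a)
    (hb : 0 ≤ b) (h₀ : u 0 ≤ 0) (h : ∀ n < N, u (n + 1) ≤ (1 + a) * u n + a * b) {n : ℕ}
    (hn : n ≤ N) : u n ≤ (Real.exp (a * N) - 1) * b := by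
  have hpow : ∀ n ≤ N, u n ≤ ((1 + a) ^ n - 1) * b := by
    intro n
    induction n with
    | zero => simpa using h₀
    | succ n ih =>
      intro hn
      calc u (n + 1) ≤ (1 + a) * u n + a * b := h n hn
        _ ≤ (1 + a) * (((1 + a) ^ n - 1) * b) + a * b := by
            gcongr
            exact ih (Nat.le_of_succ_le hn)
        _ = ((1 + a) ^ (n + 1) - 1) * b := by ring
  refine (hpow n hn).trans ?_
  gcongr
  calc (1 + a) ^ n ≤ (1 + a) ^ N := pow_le_pow_right₀ (by linarith) hn
    _ ≤ Real.exp a ^ N := by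
        gcongr
        linarith [Real.add_one_le_exp a]
    _ = Real.exp (a * N) := by rw [← Real.exp_nat_mul, mul_comm]

section Stability

variable {E : Type*} [NormedAddCommGroup E] [NormedSpace ℝ E]

theorem norm_sum_smul_le {ι : Type*} [Fintype ι] {c : ι → ℝ} {v : ι → E} {B R : ℝ}
    (hR : 0 ≤ R) (hc : ∑ i, |c i| ≤ B) (hv : ∀ i, ‖v i‖ ≤ R) :
    ‖∑ i, c i • v i‖ ≤ B * R :=
  calc ‖∑ i, c i • v i‖ ≤ ∑ i, |c i| * R := norm_sum_le_of_le _ fun i _ => by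
        rw [norm_smul, Real.norm_eq_abs]
        gcongr
        exact hv i
    _ = (∑ i, |c i|) * R := (Finset.sum_mul ..).symm
    _ ≤ B * R := by gcongr

/-- Distance between a sequence `y` that follows weighted Euler steps up to an error `K L h²` and
the Euler path `ξ` along the rounded indices `σ`, in terms of the discrepancy bound `B`. -/
theorem norm_sub_le_of_rounding {ι : Type*} [Fintype ι] [DecidableEq ι] {f : ι → E → E}
    {K L h B : ℝ} {N : ℕ}
    (hK₀ : 0 ≤ K) (hL₀ : 0 ≤ L) (hh : 0 ≤ h) (hB₀ : 0 ≤ B)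
    (hK : ∀ i y, ‖f i y‖ ≤ K) (hL : ∀ i y z, ‖f i y - f i z‖ ≤ L * ‖y - z‖)
    {y ξ : ℕ → E} {w D : ℕ → ι → ℝ} {σ : ℕ → ι}
    (hy : ∀ n < N, ‖y (n + 1) - y n‖ ≤ K * h)
    (hyw : ∀ n < N, ‖y (n + 1) - y n - h • ∑ i, w n i • f i (y n)‖ ≤ K * L * h ^ 2)
    (hξ₀ : ξ 0 = y 0) (hξ : ∀ n, ξ (n + 1) = ξ n + h • f (σ n) (ξ n))
    (hD₀ : D 0 = 0) (hD : ∀ n, D (n + 1) = D n - w n + Pi.single (σ n) 1)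
    (hB : ∀ n, ∑ i, |D n i| ≤ B) {n : ℕ} (hn : n ≤ N) :
    ‖y n - ξ n‖ ≤ (Real.exp (L * h * N) - 1) * (K * h * (1 + 2 * B)) + K * h * B := by
  set P : ℕ → E := fun n => h • ∑ i, D n i • f i (y n) with hP
  have hPle (n : ℕ) : ‖P n‖ ≤ K * h * B := by
    rw [hP, norm_smul, Real.norm_of_nonneg hh]
    calc h * _ ≤ h * (B * K) := by
          gcongr
          exact norm_sum_smul_le hK₀ (hB n) fun i => hK i _
      _ = K * h * B := by ring
  set W : ℕ → E := fun n => y n - ξ n + P n with hW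
  have herr (n : ℕ) : ‖y n - ξ n‖ ≤ ‖W n‖ + K * h * B :=
    calc ‖y n - ξ n‖ = ‖W n - P n‖ := by rw [hW, add_sub_cancel_right]
      _ ≤ ‖W n‖ + ‖P n‖ := norm_sub_le _ _
      _ ≤ ‖W n‖ + K * h * B := by gcongr; exact hPle n
  have hW₀ : ‖W 0‖ ≤ 0 := by simp [hW, hP, hD₀, hξ₀]
  have hstep : ∀ n < N, ‖W (n + 1)‖ ≤ (1 + L * h) * ‖W n‖ + L * h * (K * h * (1 + 2 * B)) := by
    intro n hn
    -- Summation by parts: the weights `w n` cancel against the increment of `D`.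
    have hsingle : ∑ i, (Pi.single (σ n) 1 : ι → ℝ) i • f i (y n) = f (σ n) (y n) := by
      simp [Pi.single_apply]
    have hDsum : ∑ i, D (n + 1) i • f i (y n) = ∑ i, D n i • f i (y n)
        - ∑ i, w n i • f i (y n) + f (σ n) (y n) := by
      rw [← hsingle, ← Finset.sum_sub_distrib, ← Finset.sum_add_distrib]
      refine Finset.sum_congr rfl fun i _ => ?_
      rw [hD, Pi.add_apply, Pi.sub_apply, add_smul, sub_smul]
    have hdecomp : W (n + 1) = W n + h • (f (σ n) (y n) - f (σ n) (ξ n))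
        + (y (n + 1) - y n - h • ∑ i, w n i • f i (y n))
        + h • ∑ i, D (n + 1) i • (f i (y (n + 1)) - f i (y n)) := by
      simp only [hW, hP, hξ, smul_sub (D (n + 1) _), Finset.sum_sub_distrib, hDsum, smul_sub,
        smul_add]
      abel
    have hmain : ‖h • (f (σ n) (y n) - f (σ n) (ξ n))‖ ≤ h * (L * (‖W n‖ + K * h * B)) := by
      rw [norm_smul, Real.norm_of_nonneg hh]
      gcongr
      refine (hL _ _ _).trans ?_
      gcongr
      exact herr n
    have hparts : ‖h • ∑ i, D (n + 1) i • (f i (y (n + 1)) - f i (y n))‖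
        ≤ h * (B * (L * (K * h))) := by
      rw [norm_smul, Real.norm_of_nonneg hh]
      gcongr
      refine norm_sum_smul_le (by positivity) (hB _) fun i => (hL _ _ _).trans ?_
      gcongr
      exact hy n hn
    rw [hdecomp]
    calc _ ≤ ‖W n‖ + h * (L * (‖W n‖ + K * h * B)) + K * L * h ^ 2 + h * (B * (L * (K * h))) :=
          norm_add_le_of_le (norm_add_le_of_le (norm_add_le_of_le le_rfl hmain) (hyw n hn)) hparts
      _ = _ := by ring
  have hgron := le_exp_sub_one_mul_of_le_one_add_mul (u := fun n => ‖W n‖) (by positivity)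
    (by positivity) hW₀ hstep hn
  exact (herr n).trans (by gcongr)

end Stability

/-! ### The convergence theorem -/

/-- Comparison of the bound of `norm_sub_le_of_rounding`, for `B = 2 (m - 1)`, with the part of the
target bound that is linear in the step size. -/
theorem exp_sub_one_mul_add_le {m K a h : ℝ} (hm : 2 ≤ m) (hK : 0 ≤ K) (hh : 0 ≤ h) :
    (Real.exp a - 1) * (K * h * (1 + 2 * (2 * (m - 1)))) + K * h * (2 * (m - 1))
      ≤ (Real.exp a * (K * a + K * (8 * m - 10)) + 2 * K * (m - 1)) * h := by
  have hexp : Real.exp a - 1 ≤ a * Real.exp a := by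
    have h₁ := mul_le_mul_of_nonneg_right (Real.add_one_le_exp (-a)) (Real.exp_pos a).le
    rw [← Real.exp_add, neg_add_cancel, Real.exp_zero] at h₁
    linarith
  have hmul := mul_le_mul_of_nonneg_left hexp (mul_nonneg hK hh)
  have hm' := mul_nonneg (mul_nonneg hK hh)
    (mul_nonneg (Real.exp_pos a).le (by linarith : (0 : ℝ) ≤ 4 * m - 6))
  have hm'' := mul_nonneg (mul_nonneg hK hh) (by linarith : (0 : ℝ) ≤ 4 * (m - 1))
  linarith

theorem mainTheorem2 (d M N : ℕ) (hd : 1 ≤ d) (hM : d + 1 ≤ M) (hN : 1 ≤ N)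
    (T K L S Δt : ℝ) (hT : 0 < T) (hL : 0 < L) (hS : 0 < S) (hΔt : Δt = T / (N : ℝ))
    (f : Fin M → EuclideanSpace ℝ (Fin d) → EuclideanSpace ℝ (Fin d))
    (hdiff : ∀ i, Differentiable ℝ (f i))
    (hTaylor : ∀ i x z, ‖f i x - f i z - fderiv ℝ (f i) z (x - z)‖ ≤ S * ‖x - z‖ ^ 2)
    (hbound : ∀ i x, ‖f i x‖ ≤ K)
    (hjac : ∀ i x, ‖fderiv ℝ (f i) x‖ ≤ L)
    (x₀ : EuclideanSpace ℝ (Fin d)) (x : ℝ → EuclideanSpace ℝ (Fin d))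
    (hx : IsInclusionSolution (finiteInclusion f) x₀ T x) :
    ∃ ξ : ℕ → EuclideanSpace ℝ (Fin d),
      IsForwardEulerPath (finiteInclusion f) x₀ Δt N ξ ∧
      ∀ n ≤ N, ‖x (n * Δt) - ξ n‖ ≤
        (Real.exp (L * T) * (K * L * T + K * (8 * (M : ℝ) - 10)) + 2 * K * ((M : ℝ) - 1)) * Δt
        + Real.exp (L * T) *
            (K * L * ((M : ℝ) - 1) * ((M : ℝ) - 2)
              + 2 * K * L * ((((M : ℝ) - 1) ^ 3 - ((M : ℝ) - 1)) / 3)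
                  * (1 + L * Δt) ^ ((M : ℤ) - 3)
              + 2 * S * K ^ 2 * ((M : ℝ) * ((M : ℝ) - 1) * (2 * (M : ℝ) - 1) / (3 * L)))
            * Δt ^ 2 := by
  have hM₂ : 2 ≤ M := by lia
  have hMR : (2 : ℝ) ≤ M := by exact_mod_cast hM₂
  have : Nonempty (Fin M) := ⟨⟨0, by lia⟩⟩
  have hK : 0 ≤ K := (norm_nonneg _).trans (hbound ⟨0, by lia⟩ 0)
  have hNR : (0 : ℝ) < N := by exact_mod_cast hN
  have hΔ : 0 < Δt := hΔt ▸ div_pos hT hNR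
  have hNΔ : N * Δt = T := by rw [hΔt]; field_simp
  have hLip : ∀ i y z, ‖f i y - f i z‖ ≤ L * ‖y - z‖ := fun i y z =>
    convex_univ.norm_image_sub_le_of_norm_fderiv_le (fun p _ => hdiff i p) (fun p _ => hjac i p)
      (mem_univ z) (mem_univ y)
  have hvel : ∀ᵐ t, t ∈ Icc 0 T → ∃ i, HasDerivAt x (f i (x t)) t := by
    filter_upwards [(ae_restrict_iff' measurableSet_Icc).1 hx.deriv_mem] with t ht htT
    obtain ⟨_, ⟨i, rfl⟩, hi⟩ := ht htT
    exact ⟨i, hi⟩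
  -- The solution, restricted to one time step.
  have hstep (n : ℕ) (hn : n < N) : (n : ℝ) * Δt < (n + 1 : ℕ) * Δt ∧
      Icc ((n : ℝ) * Δt) ((n + 1 : ℕ) * Δt) ⊆ Icc 0 T := by
    have hn' : ((n + 1 : ℕ) : ℝ) ≤ N := by exact_mod_cast hn
    refine ⟨?_, Icc_subset_Icc (by positivity) ?_⟩
    · gcongr
      exact n.lt_succ_self
    · rw [← hNΔ]
      gcongr
  have hlen (n : ℕ) : ((n + 1 : ℕ) : ℝ) * Δt - n * Δt = Δt := by push_cast; ring
  have hac (n : ℕ) (hn : n < N) :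
      AbsolutelyContinuousOnInterval x (n * Δt) ((n + 1 : ℕ) * Δt) := by
    refine hx.absolutelyContinuous.mono ?_
    rw [uIcc_of_le (hstep n hn).1.le, uIcc_of_le hT.le]
    exact (hstep n hn).2
  have hinc : ∀ n < N, ‖x ((n + 1 : ℕ) * Δt) - x (n * Δt)‖ ≤ K * Δt := by
    intro n hn
    have h := (hac n hn).norm_sub_le_of_velocity_le (K := K) (hstep n hn).1.le (by
      filter_upwards [hvel] with t ht htn
      obtain ⟨i, hi⟩ := ht ((hstep n hn).2 htn)
      exact ⟨_, hbound i _, hi⟩)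
    rwa [hlen] at h
  have hweights : ∀ n, ∃ w ∈ stdSimplex ℝ (Fin M), n < N →
      ‖x ((n + 1 : ℕ) * Δt) - x (n * Δt) - Δt • ∑ i, w i • f i (x (n * Δt))‖
        ≤ K * L * Δt ^ 2 := by
    intro n
    by_cases hn : n < N
    · obtain ⟨w, hw, hle⟩ := exists_weights_norm_sub_le hbound hK hL.le hLip (hac n hn)
        (hstep n hn).1 (hvel.mono fun t ht htn => ht ((hstep n hn).2 htn))
      rw [hlen] at hle
      exact ⟨w, hw, fun _ => hle⟩
    -- Beyond the last step any weights will do.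
    · exact ⟨_, single_mem_stdSimplex ℝ (Classical.arbitrary (Fin M)), fun h => absurd h hn⟩
  choose w hw hwle using hweights
  obtain ⟨σ, D, hD₀, hD, hB⟩ := exists_rounding hw
  rw [Fintype.card_fin] at hB
  let ξ : ℕ → EuclideanSpace ℝ (Fin d) := fun n =>
    Nat.rec x₀ (fun n p => p + Δt • f (σ n) p) n
  refine ⟨ξ, ⟨rfl, fun n _ => ⟨_, mem_range_self (σ n), rfl⟩⟩, fun n hn => ?_⟩
  have hmain := norm_sub_le_of_rounding (y := fun n : ℕ => x (n * Δt)) (ξ := ξ) hK hL.le hΔ.le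
    (by linarith) hbound hLip hinc hwle (by simp [ξ, hx.initial]) (fun _ => rfl) hD₀ hD hB hn
  rw [show L * Δt * N = L * T by rw [← hNΔ]; ring] at hmain
  have hcompare := exp_sub_one_mul_add_le (a := L * T) hMR hK hΔ.le
  rw [← mul_assoc K L T] at hcompare
  refine (hmain.trans hcompare).trans (le_add_of_nonneg_right ?_)
  have h₁ : 0 ≤ (M : ℝ) - 1 := by linarith
  have h₂ : 0 ≤ (M : ℝ) - 2 := by linarith
  have h₃ : 0 ≤ 2 * (M : ℝ) - 1 := by linarith
  have h₄ : 0 ≤ ((M : ℝ) - 1) ^ 3 - ((M : ℝ) - 1) := by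
    rw [show ((M : ℝ) - 1) ^ 3 - ((M : ℝ) - 1) = ((M : ℝ) - 1) * ((M : ℝ) * ((M : ℝ) - 2)) by ring]
    positivity
  positivity
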